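/- Let $C[-1,1]$ be the space of continuous real functions on $[-1,1]$ with the uniform norm $\|\cdot\|_\infty$, let $T_k$ be the Chebyshev polynomial of degree $k$ (so that $T_k(\cos\theta)=\cos(k\theta)$), and let $f\in C[-1,1]$. For $n,k\ge 0$ put: - $E_n(f)=\inf\{\|f-P\|_\infty : P \text{ a real polynomial of degree}\le n\}$; - $A_k(f)=\frac{2}{\pi}\int_{-1}^{1}\frac{f(x)T_k(x)}{\sqrt{1-x^2}}\,dx$; - $S_n(f)=\|f-s_n(f)\|_\infty$, where $s_n(f)=\frac{A_0(f)}{2}+\sum_{k=1}^{n}A_k(f)\,T_k$; - $u_n^{[n+1]}=\frac{\alpha_0}{2}+\sum_{k=1}^{n}\alpha_k T_k$, where $\alpha_k=\frac{2}{n+1}\sum_{i=1}^{n+1}f(\xi_i)T_k(\xi_i)$ and $\xi_i=\cos\left(\frac{2i-1}{n+1}\cdot\frac{\pi}{2}\right)$, $1\le i\le n+1$, are the zeros of $T_{n+1}$; this is the polynomial of degree $\le n$ that interpolates $f$ at the zeros of $T_{n+1}$. Say that $f$ is in the Gevrey class if it is indefinitely differentiable on $[-1,1]$ (with one-sided derivatives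 at the end points) and there are $\alpha>0$, $M>0$, $R>0$ such that $\|f^{(n)}\|_\infty\le M R^n n^{\alpha n}$ for all $n\ge 0$ (with $0^0=1$). Theorem 5.2.4. For every $f\in C[-1,1]$ the following nine properties are equivalent ($n$ and $m$ are natural numbers; all other quantified quantities are real): - (i) $\exists M>0,\ r\in(0,1),\ \gamma>0\ \ \forall n>0,\ E_n(f)\le M r^{n^\gamma}$; - (ii) $\exists M>0,\ r\in(0,1),\ \gamma>0\ \ \forall n>0,\ S_n(f)\le M r^{n^\gamma}$; - (iii) $\exists M>0,\ r\in(0,1),\ \gamma>0\ \ \forall n>0,\ |A_n(f)|\le M r^{n^\gamma}$; - (iv) $\exists M>0,\ r\in(0,1),\ \gamma>0\ \ \forall n>0,\ \|u_n^{[n+1]}-f\|_\infty\le M r^{n^\gamma}$; - (j) $\exists c,\beta>0\ \ \forall n>0\ \ \forall m\ge c\,n^\beta,\ E_m(f)\le 1/2^n$; - (jj) $\exists c,\beta>0\ \ \forall n>0\ \ \forall m\ge c\,n^\beta,\ S_m(f)\le 1/2^n$; - (jjj) $\exists c,\beta>0\ \ \forall n>0\ \ \forall m\ge c\,n^\beta,\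 |A_m(f)|\le 1/2^n$; - (jw) $\exists c,\beta>0\ \ \forall n>0\ \ \forall m\ge c\,n^\beta,\ \|u_m^{[m+1]}-f\|_\infty\le 1/2^n$; - (k) $f$ is in the Gevrey class. -/

import Mathlib

open scoped ContDiff

/-- The segment `[-1, 1]`, so that `C(unitSegment, ℝ)` with its sup norm is the space
`C[-1, 1]` of continuous real functions with the uniform norm. -/
abbrev unitSegment : Set ℝ := Set.Icc (-1 : ℝ) 1

/-- The restriction of a polynomial to `[-1, 1]`, as a continuous function. -/
noncomputable abbrev polyOn (P : Polynomial ℝ) : C(unitSegment, ℝ) :=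
  P.toContinuousMapOn unitSegment

/-- The set of the functions on `[-1, 1]` given by polynomials of degree at most `n`. -/
def polysDegreeLE (n : ℕ) : Set C(unitSegment, ℝ) :=
  {g | ∃ P : Polynomial ℝ, P.natDegree ≤ n ∧ g = polyOn P}

/-- A function on `[-1, 1]` seen as a function on `ℝ` (constant on either side of `[-1, 1]`);
only its values on `[-1, 1]` are ever used. -/
noncomputable def extendR (f : C(unitSegment, ℝ)) : ℝ → ℝ :=
  Set.IccExtend (by norm_num : (-1 : ℝ) ≤ 1) f

/-- `E_n(f)`: the uniform distance from `f` to the polynomials of degree at most `n`. -/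
noncomputable def bestApprox (f : C(unitSegment, ℝ)) (n : ℕ) : ℝ :=
  Metric.infDist f (polysDegreeLE n)

/-- `A_k(f)`: the `k`-th Chebyshev coefficient of `f`. -/
noncomputable def chebCoeff (f : C(unitSegment, ℝ)) (k : ℕ) : ℝ :=
  2 / Real.pi * ∫ x in (-1 : ℝ)..1,
    extendR f x * (Polynomial.Chebyshev.T ℝ k).eval x / Real.sqrt (1 - x ^ 2)

/-- The polynomial `a_0 / 2 + a_1 T_1 + ... + a_n T_n`. -/
noncomputable def chebSum (a : ℕ → ℝ) (n : ℕ) : Polynomial ℝ :=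
  Polynomial.C (a 0 / 2) +
    ∑ k ∈ Finset.Icc 1 n, Polynomial.C (a k) * Polynomial.Chebyshev.T ℝ k

/-- `S_n(f) = ‖f - s_n(f)‖`: the error of the truncated Chebyshev series of `f`. -/
noncomputable def chebTruncError (f : C(unitSegment, ℝ)) (n : ℕ) : ℝ :=
  ‖f - polyOn (chebSum (chebCoeff f) n)‖

/-- `ξ_i^{[m]}`, for `1 ≤ i ≤ m`: the zeros of `T_m`. -/
noncomputable def chebNode (m i : ℕ) : ℝ :=
  Real.cos ((2 * (i : ℝ) - 1) / m * (Real.pi / 2))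

/-- `α_k^{[m]}(f)`: the discrete Chebyshev coefficients of `f` at the zeros of `T_m`. -/
noncomputable def discreteChebCoeff (f : C(unitSegment, ℝ)) (m k : ℕ) : ℝ :=
  2 / (m : ℝ) * ∑ i ∈ Finset.Icc 1 m,
    extendR f (chebNode m i) * (Polynomial.Chebyshev.T ℝ k).eval (chebNode m i)

/-- `u_n^{[m]}(f) = α_0^{[m]} / 2 + α_1^{[m]} T_1 + ... + α_n^{[m]} T_n`. For `m = n + 1` it is the
polynomial of degree at most `n` that interpolates `f` at the zeros of `T_{n+1}`, see
`chebU_interpolates`. -/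
noncomputable def chebU (f : C(unitSegment, ℝ)) (m n : ℕ) : Polynomial ℝ :=
  chebSum (discreteChebCoeff f m) n

/-- `‖u_n^{[n+1]} - f‖`: the error of interpolation of `f` at the zeros of `T_{n+1}`. -/
noncomputable def chebInterpError (f : C(unitSegment, ℝ)) (n : ℕ) : ℝ :=
  ‖polyOn (chebU f (n + 1) n) - f‖

/-- `f` is in the Gevrey class of order `α`: it is indefinitely differentiable on `[-1, 1]`
(with one-sided derivatives at the end points), and `‖f^{(n)}‖ ≤ M R^n n^{α n}` for all `n`,
with the convention `0 ^ 0 = 1` for `n = 0`. -/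
def IsGevreyOfOrder (α : ℝ) (f : C(unitSegment, ℝ)) : Prop :=
  ContDiffOn ℝ ∞ (extendR f) unitSegment ∧
    ∃ M R : ℝ, 0 < M ∧ 0 < R ∧ ∀ n : ℕ, ∀ x ∈ unitSegment,
      |iteratedDerivWithin n (extendR f) unitSegment x| ≤
        M * R ^ n * (n : ℝ) ^ (α * (n : ℝ))

/-- `f` is in the Gevrey class: it is so for some order `α > 0`. -/
def IsGevrey (f : C(unitSegment, ℝ)) : Prop :=
  ∃ α : ℝ, 0 < α ∧ IsGevreyOfOrder α f

lemma cosSum_aux (m : ℕ) (t : ℝ) :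
    2 * Real.sin (t / 2) * (1 / 2 + ∑ k ∈ Finset.Icc 1 m, Real.cos (k * t)) =
      Real.sin ((m + 1 / 2) * t) := by
  induction m with
  | zero => simp; ring_nf
  | succ m ih =>
    rw [Finset.sum_Icc_succ_top (by omega), ← add_assoc, mul_add, ih]
    have e1 : ((m : ℝ) + 1 / 2) * t = ((m + 1 : ℕ) : ℝ) * t - t / 2 := by push_cast; ring
    have e2 : (((m + 1 : ℕ) : ℝ) + 1 / 2) * t = ((m + 1 : ℕ) : ℝ) * t + t / 2 := by ring
    rw [e1, e2, Real.sin_sub, Real.sin_add]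
    ring

lemma cosSum_int (n : ℕ) (p : ℤ) (h0 : 0 < |p|) (h1 : |p| < 2 * (n + 1)) :
    1 / 2 + ∑ k ∈ Finset.Icc 1 n, Real.cos (k * (p * Real.pi / (n + 1))) =
      - (-1 : ℝ) ^ p / 2 := by
  have hn : ((n : ℝ) + 1) ≠ 0 := by positivity
  have hs : Real.sin (p * Real.pi / (n + 1) / 2) ≠ 0 := by
    intro h
    obtain ⟨q, hq⟩ := Real.sin_eq_zero_iff.1 h
    have hpi := Real.pi_ne_zero
    field_simp at hq
    have hq' : q * (2 * ((n : ℤ) + 1)) = p := by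
      have : (q : ℝ) * (2 * ((n : ℝ) + 1)) = p := by linarith
      exact_mod_cast this
    have hd : (2 * ((n : ℤ) + 1)) ∣ p := ⟨q, by rw [← hq']; ring⟩
    have := Int.eq_zero_of_abs_lt_dvd hd h1
    simp [this] at h0
  have key := cosSum_aux n (p * Real.pi / (n + 1))
  have e : ((n : ℝ) + 1 / 2) * (p * Real.pi / (n + 1)) =
      p * Real.pi - p * Real.pi / (n + 1) / 2 := by
    field_simp; ring
  rw [e, Real.sin_sub, Real.sin_int_mul_pi, Real.cos_int_mul_pi] at key
  apply mul_left_cancel₀ hs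
  linarith

lemma chebKernel (n i j : ℕ) (hi : i ∈ Finset.Icc 1 (n + 1)) (hj : j ∈ Finset.Icc 1 (n + 1)) :
    1 / 2 + ∑ k ∈ Finset.Icc 1 n, (Polynomial.Chebyshev.T ℝ k).eval (chebNode (n + 1) i) *
      (Polynomial.Chebyshev.T ℝ k).eval (chebNode (n + 1) j) =
      if i = j then ((n : ℝ) + 1) / 2 else 0 := by
  rw [Finset.mem_Icc] at hi hj
  have hn : ((n : ℝ) + 1) ≠ 0 := by positivity
  have hterm : ∀ k ∈ Finset.Icc 1 n,
      (Polynomial.Chebyshev.T ℝ k).eval (chebNode (n + 1) i) *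
        (Polynomial.Chebyshev.T ℝ k).eval (chebNode (n + 1) j) =
      (Real.cos (k * (((i : ℤ) - j : ℤ) * Real.pi / (n + 1))) +
        Real.cos (k * (((i : ℤ) + j - 1 : ℤ) * Real.pi / (n + 1)))) / 2 := by
    intro k _
    rw [chebNode, chebNode, Polynomial.Chebyshev.T_real_cos, Polynomial.Chebyshev.T_real_cos]
    have e1 : (k : ℝ) * (((i : ℤ) - j : ℤ) * Real.pi / (n + 1)) =
        ((k : ℤ) : ℝ) * ((2 * (i : ℝ) - 1) / (n + 1 : ℕ) * (Real.pi / 2)) -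
        ((k : ℤ) : ℝ) * ((2 * (j : ℝ) - 1) / (n + 1 : ℕ) * (Real.pi / 2)) := by
      push_cast; field_simp; ring
    have e2 : (k : ℝ) * (((i : ℤ) + j - 1 : ℤ) * Real.pi / (n + 1)) =
        ((k : ℤ) : ℝ) * ((2 * (i : ℝ) - 1) / (n + 1 : ℕ) * (Real.pi / 2)) +
        ((k : ℤ) : ℝ) * ((2 * (j : ℝ) - 1) / (n + 1 : ℕ) * (Real.pi / 2)) := by
      push_cast; field_simp; ring
    rw [e1, e2, Real.cos_sub, Real.cos_add]
    ring
  rw [Finset.sum_congr rfl hterm, ← Finset.sum_div, Finset.sum_add_distrib]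
  have h2 := cosSum_int n ((i : ℤ) + j - 1) (by rw [abs_of_pos] <;> omega)
    (by rw [abs_of_pos] <;> omega)
  by_cases hij : i = j
  · subst hij
    have ho : Odd ((i : ℤ) + i - 1) := ⟨(i : ℤ) - 1, by ring⟩
    rw [ho.neg_one_zpow] at h2
    have : ∑ k ∈ Finset.Icc 1 n, Real.cos (k * (((i : ℤ) - i : ℤ) * Real.pi / (n + 1))) = n := by
      simp
    rw [this, if_pos rfl]
    linarith
  · have h1 := cosSum_int n ((i : ℤ) - j) (by rw [abs_pos]; omega) (by rw [abs_lt]; omega)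
    have e : (-1 : ℝ) ^ ((i : ℤ) + j - 1) = - (-1 : ℝ) ^ ((i : ℤ) - j) := by
      have : (i : ℤ) + j - 1 = ((i : ℤ) - j) + (2 * (j - 1) + 1) := by ring
      have ho : Odd (2 * ((j : ℤ) - 1) + 1) := ⟨_, rfl⟩
      rw [this, zpow_add₀ (by norm_num), ho.neg_one_zpow]
      ring
    rw [e] at h2
    rw [if_neg hij]
    linarith

/-- `u_n^{[n+1]}` interpolates `f` at the zeros of `T_{n+1}`. -/
theorem chebU_interpolates (f : C(unitSegment, ℝ)) (n j : ℕ) (hj : j ∈ Finset.Icc 1 (n + 1)) :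
    (chebU f (n + 1) n).eval (chebNode (n + 1) j) = extendR f (chebNode (n + 1) j) := by
  have hn : ((n : ℝ) + 1) ≠ 0 := by positivity
  have h : (chebU f (n + 1) n).eval (chebNode (n + 1) j) =
      2 / ((n : ℝ) + 1) * ∑ i ∈ Finset.Icc 1 (n + 1), extendR f (chebNode (n + 1) i) *
        (1 / 2 + ∑ k ∈ Finset.Icc 1 n,
          (Polynomial.Chebyshev.T ℝ k).eval (chebNode (n + 1) i) *
          (Polynomial.Chebyshev.T ℝ k).eval (chebNode (n + 1) j)) := by
    simp only [chebU, chebSum, discreteChebCoeff, Polynomial.eval_add, Polynomial.eval_C,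
      Polynomial.eval_finsetSum, Polynomial.eval_mul, mul_add, Finset.sum_add_distrib]
    congr 1
    · simp [Finset.mul_sum, Finset.sum_div]
      refine Finset.sum_congr rfl fun i _ => by ring
    · simp only [Finset.mul_sum, Finset.sum_mul]
      rw [Finset.sum_comm]
      refine Finset.sum_congr rfl fun i _ => Finset.sum_congr rfl fun k _ => ?_
      push_cast; ring
  rw [h, Finset.sum_congr rfl fun i hi => by rw [chebKernel n i j hi hj]]
  simp only [mul_ite, mul_zero, Finset.sum_ite_eq', if_pos hj]
  field_simp

/-!
Decay of the form `M r ^ (n ^ γ)` is not affected by factors polynomial in `n`, by shifts of `n`, or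
by passing to the tail of the series. The best approximation, the truncated Chebyshev series, the
interpolation polynomial and the Chebyshev coefficients control one another up to such changes, and
the smoothness of `f` is tied to its Chebyshev coefficients by differentiating the series and by
integrating by parts.

* For each of the four error sequences, decay like `M r ^ (n ^ γ)` (`IsSubexpDecay`) is the same
  as reaching the precision `2 ^ (-n)` at a degree polynomial in `n` (`IsPolyModulus`), with
  `β = 1 / γ`: `isSubexpDecay_iff_isPolyModulus`.
* `f ↦ u_n^{[n+1]}(f)` is a linear projection onto the polynomials of degree at most `n`, of norm at
  most `2 n + 1`, so that `‖u_n^{[n+1]} - f‖ ≤ (2 n + 2) E_n`: `norm_sub_le_of_projection`.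
  Orthogonality gives `|A_{n+1}| ≤ 2 E_n`: `abs_chebCoeff_succ_le`.
* If the coefficients decay then the Chebyshev series converges absolutely, and its sum is `f`
  because Chebyshev coefficients determine a continuous function: `hasSum_chebSeries`. The tail of
  the series bounds `S_n`. The series can also be differentiated term by term; since
  `|T_k^{(n)}| ≤ k ^ (2 n)` on `[-1, 1]`, the `n`-th derivative is at most
  `∑ M r ^ (k ^ γ) k ^ (2 n)`, which has Gevrey growth of order `2 / γ`: `IsSubexpDecay.isGevrey`.
* Conversely, `2 k A_k(f) = A_{k-1}(f') - A_{k+1}(f')`, so that `p ≤ k / 2` such steps give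
  `|A_k(f)| ≤ 2 ‖f^{(p)}‖ (2 / k) ^ p`. If `‖f^{(p)}‖ ≤ M R ^ p p ^ (α p)` and `k` is at least a
  multiple of `p ^ α`, this is at most `2 M 2 ^ (-p)`: `IsGevrey.isPolyModulus`.
-/

open Filter Topology
open Polynomial.Chebyshev (T)

/-! ### Subexponential decay of sequences -/

/-- `e n` is at most `M r ^ (n ^ γ)`, for some `M`, some `r < 1` and some exponent `γ > 0`. -/
def IsSubexpDecay (e : ℕ → ℝ) : Prop :=
  ∃ M r γ : ℝ, 0 < M ∧ 0 < r ∧ r < 1 ∧ 0 < γ ∧ ∀ n : ℕ, 0 < n → e n ≤ M * r ^ ((n : ℝ) ^ γ)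

/-- `e m ≤ 2 ^ (-n)` as soon as `m ≥ c n ^ β`: the precision `2 ^ (-n)` is reached after
polynomially many steps. -/
def IsPolyModulus (e : ℕ → ℝ) : Prop :=
  ∃ c β : ℝ, 0 < c ∧ 0 < β ∧
    ∀ n : ℕ, 0 < n → ∀ m : ℕ, c * (n : ℝ) ^ β ≤ m → e m ≤ 1 / 2 ^ n

lemma IsSubexpDecay.mono {e e' : ℕ → ℝ} (h : IsSubexpDecay e) (hle : ∀ n, e' n ≤ e n) :
    IsSubexpDecay e' := by
  obtain ⟨M, r, γ, hM, hr, hr1, hγ, h⟩ := h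
  exact ⟨M, r, γ, hM, hr, hr1, hγ, fun n hn => (hle n).trans (h n hn)⟩

lemma IsSubexpDecay.isPolyModulus {e : ℕ → ℝ} (h : IsSubexpDecay e) : IsPolyModulus e := by
  obtain ⟨M, r, γ, hM, hr, hr1, hγ, h⟩ := h
  have hlr : 0 < -Real.log r := by linarith [Real.log_neg hr hr1]
  have hl2 : 0 < Real.log 2 := Real.log_pos (by norm_num)
  set K : ℝ := (|Real.log M| + Real.log 2) / -Real.log r with hK
  have hKpos : 0 < K := by positivity
  refine ⟨K ^ γ⁻¹, γ⁻¹, by positivity, by positivity, fun n hn m hm => ?_⟩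
  have hn1 : (1 : ℝ) ≤ n := by exact_mod_cast hn
  have hm0 : 0 < m := by
    have : (0 : ℝ) < K ^ γ⁻¹ * (n : ℝ) ^ γ⁻¹ := by positivity
    exact_mod_cast this.trans_le hm
  refine (h m hm0).trans ?_
  have hmγ : K * n ≤ (m : ℝ) ^ γ := by
    rw [← Real.mul_rpow (by positivity) (by positivity)] at hm
    calc K * n = ((K * n) ^ γ⁻¹) ^ γ := by
          rw [← Real.rpow_mul (by positivity), inv_mul_cancel₀ hγ.ne', Real.rpow_one]
      _ ≤ (m : ℝ) ^ γ := Real.rpow_le_rpow (by positivity) hm hγ.le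
  have hlog : Real.log M + (m : ℝ) ^ γ * Real.log r ≤ -(n * Real.log 2) := by
    have h1 : K * n * -Real.log r ≤ (m : ℝ) ^ γ * -Real.log r := by gcongr
    have h2 : K * n * -Real.log r = (|Real.log M| + Real.log 2) * n := by
      rw [hK, mul_right_comm, div_mul_cancel₀ _ hlr.ne']
    have h3 : Real.log M ≤ |Real.log M| * n :=
      (le_abs_self _).trans (le_mul_of_one_le_right (abs_nonneg _) hn1)
    nlinarith
  calc M * r ^ ((m : ℝ) ^ γ) = Real.exp (Real.log M + (m : ℝ) ^ γ * Real.log r) := by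
        rw [Real.exp_add, Real.exp_log hM, Real.rpow_def_of_pos hr, mul_comm (Real.log r)]
    _ ≤ Real.exp (-(n * Real.log 2)) := Real.exp_le_exp.2 hlog
    _ = 1 / 2 ^ n := by
        rw [Real.exp_neg, Real.exp_nat_mul, Real.exp_log (by norm_num), one_div]

lemma IsPolyModulus.isSubexpDecay {e : ℕ → ℝ} (h : IsPolyModulus e) : IsSubexpDecay e := by
  obtain ⟨c, β, hc, hβ, h⟩ := h
  set r : ℝ := (1 / 2) ^ ((1 / c) ^ β⁻¹) with hr
  have hr0 : 0 < r := by positivity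
  have hr1 : r < 1 := Real.rpow_lt_one (by norm_num) (by norm_num) (by positivity)
  refine ⟨2 + ∑ m ∈ Finset.range ⌈c⌉₊, |e m| / r ^ ((m : ℝ) ^ β⁻¹), r, β⁻¹, by positivity, hr0, hr1,
    by positivity, fun m hm => ?_⟩
  have hsum : 0 ≤ ∑ m ∈ Finset.range ⌈c⌉₊, |e m| / r ^ ((m : ℝ) ^ β⁻¹) := by positivity
  rcases lt_or_ge (m : ℝ) c with hmc | hmc
  · have hmem : m ∈ Finset.range ⌈c⌉₊ := Finset.mem_range.2 (Nat.lt_ceil.2 hmc)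
    have h1 := Finset.single_le_sum (f := fun m : ℕ => |e m| / r ^ ((m : ℝ) ^ β⁻¹))
      (fun i _ => by positivity) hmem
    have hp : 0 < r ^ ((m : ℝ) ^ β⁻¹) := by positivity
    calc e m ≤ |e m| / r ^ ((m : ℝ) ^ β⁻¹) * r ^ ((m : ℝ) ^ β⁻¹) := by
          rw [div_mul_cancel₀ _ hp.ne']; exact le_abs_self _
      _ ≤ _ := by gcongr; linarith
  · -- the largest precision `n` that `m` guarantees
    set n : ℕ := ⌊((m : ℝ) / c) ^ β⁻¹⌋₊ with hn
    have hmc1 : 1 ≤ (m : ℝ) / c := (one_le_div hc).2 hmc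
    have hn1 : 0 < n := Nat.floor_pos.2 (Real.one_le_rpow hmc1 (by positivity))
    have hnle : (n : ℝ) ≤ ((m : ℝ) / c) ^ β⁻¹ := Nat.floor_le (by positivity)
    have hlt : ((m : ℝ) / c) ^ β⁻¹ - 1 ≤ n := by
      have := Nat.lt_floor_add_one (((m : ℝ) / c) ^ β⁻¹)
      linarith
    have hcn : c * (n : ℝ) ^ β ≤ m := by
      have : (n : ℝ) ^ β ≤ m / c := by
        calc (n : ℝ) ^ β ≤ (((m : ℝ) / c) ^ β⁻¹) ^ β := by gcongr
          _ = m / c := by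
            rw [← Real.rpow_mul (by positivity), inv_mul_cancel₀ hβ.ne', Real.rpow_one]
      rw [le_div_iff₀ hc] at this
      linarith
    calc e m ≤ 1 / 2 ^ n := h n hn1 m hcn
      _ = (1 / 2 : ℝ) ^ (n : ℝ) := by rw [Real.rpow_natCast, one_div_pow]
      _ ≤ (1 / 2 : ℝ) ^ (((m : ℝ) / c) ^ β⁻¹ - 1) :=
        Real.rpow_le_rpow_of_exponent_ge (by norm_num) (by norm_num) hlt
      _ = 2 * r ^ ((m : ℝ) ^ β⁻¹) := by
        rw [Real.rpow_sub (by norm_num), Real.rpow_one, hr, ← Real.rpow_mul (by norm_num),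
          ← Real.mul_rpow (by positivity) (by positivity), one_div_mul_eq_div c]
        ring
      _ ≤ _ := by gcongr; linarith

lemma isSubexpDecay_iff_isPolyModulus {e : ℕ → ℝ} : IsSubexpDecay e ↔ IsPolyModulus e :=
  ⟨IsSubexpDecay.isPolyModulus, IsPolyModulus.isSubexpDecay⟩

/-- With `y = x ^ γ`, `p = q / γ` and `t = -log r` the left-hand side is `y ^ p e ^ (-t y)`, which
is at most `(p / t) ^ p`. For `q = 0` the right-hand side is `0 ^ 0 = 1`. -/
lemma rpow_mul_rpow_rpow_le {r γ q x : ℝ} (hr : 0 < r) (hr1 : r < 1) (hγ : 0 < γ) (hq : 0 ≤ q)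
    (hx : 0 ≤ x) :
    x ^ q * r ^ (x ^ γ) ≤ (q / (γ * -Real.log r)) ^ (q / γ) := by
  have hl : 0 < -Real.log r := by linarith [Real.log_neg hr hr1]
  set t := -Real.log r with ht
  set y := x ^ γ with hy
  have hy0 : 0 ≤ y := by positivity
  have hxy : x ^ q = y ^ (q / γ) := by
    rw [hy, ← Real.rpow_mul hx, mul_div_cancel₀ _ hγ.ne']
  have hry : r ^ y = Real.exp (-(t * y)) := by
    rw [Real.rpow_def_of_pos hr]; congr 1; rw [ht]; ring
  rcases hq.eq_or_lt with rfl | hq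
  · simpa using Real.rpow_le_one hr.le hr1.le hy0
  have hp : 0 < q / γ := by positivity
  -- `y ≤ (p / t) e ^ (t y / p)` with `p = q / γ`, from `1 + s ≤ e ^ s`
  have h1 : y ≤ q / (γ * t) * Real.exp (t * y / (q / γ)) := by
    have := Real.add_one_le_exp (t * y / (q / γ))
    calc y = q / (γ * t) * (t * y / (q / γ)) := by field_simp
      _ ≤ _ := by gcongr; linarith
  calc x ^ q * r ^ y ≤ (q / (γ * t) * Real.exp (t * y / (q / γ))) ^ (q / γ) * r ^ y := by
        rw [hxy]; gcongr
    _ = (q / (γ * t)) ^ (q / γ) := by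
        rw [Real.mul_rpow (by positivity) (by positivity), ← Real.exp_mul,
          div_mul_cancel₀ _ hp.ne', hry, mul_assoc, ← Real.exp_add]
        simp

lemma rpow_eq_sqrt_mul_sqrt {r : ℝ} (hr : 0 < r) (x : ℝ) :
    r ^ x = √r ^ x * √r ^ x := by
  rw [← Real.mul_rpow (by positivity) (by positivity), Real.mul_self_sqrt hr.le]

lemma sqrt_lt_one_of_lt_one {r : ℝ} (hr1 : r < 1) : √r < 1 := by
  rw [Real.sqrt_lt' one_pos]; simpa using hr1

/-- A factor that is linear in `n` is absorbed by replacing the ratio `r` by `√r`. -/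
lemma IsSubexpDecay.of_le_mul {e e' : ℕ → ℝ} (h : IsSubexpDecay e)
    (hle : ∀ n, e' n ≤ (2 * n + 2) * e n) : IsSubexpDecay e' := by
  obtain ⟨M, r, γ, hM, hr, hr1, hγ, h⟩ := h
  have hs1 := sqrt_lt_one_of_lt_one hr1
  have hs : 0 < √r := Real.sqrt_pos.2 hr
  have hl : 0 < -Real.log √r := by linarith [Real.log_neg hs hs1]
  refine ⟨4 * (1 / (γ * -Real.log √r)) ^ (1 / γ) * M, √r, γ, by positivity, hs, hs1, hγ,
    fun n hn => ?_⟩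
  have hn1 : (1 : ℝ) ≤ n := by exact_mod_cast hn
  have hkey := rpow_mul_rpow_rpow_le hs hs1 hγ zero_le_one (Nat.cast_nonneg n)
  rw [Real.rpow_one] at hkey
  calc e' n ≤ (2 * n + 2) * e n := hle n
    _ ≤ (2 * n + 2) * (M * r ^ ((n : ℝ) ^ γ)) := by gcongr; exact h n hn
    _ ≤ (4 * n) * (M * r ^ ((n : ℝ) ^ γ)) := by gcongr; linarith
    _ = 4 * ((n : ℝ) * √r ^ ((n : ℝ) ^ γ)) * M * √r ^ ((n : ℝ) ^ γ) := by
      rw [rpow_eq_sqrt_mul_sqrt hr]; ring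
    _ ≤ _ := by gcongr

lemma IsSubexpDecay.of_le_pred {e e' : ℕ → ℝ} (h : IsSubexpDecay e) {C : ℝ} (hC : 0 < C)
    (hle : ∀ n, e' (n + 1) ≤ C * e n) : IsSubexpDecay e' := by
  obtain ⟨M, r, γ, hM, hr, hr1, hγ, h⟩ := h
  set s : ℝ := r ^ ((1 / 2 : ℝ) ^ γ) with hs
  have hs0 : 0 < s := by positivity
  refine ⟨C * M + |e' 1| / s, s, γ, by positivity, hs0,
    Real.rpow_lt_one hr.le hr1 (by positivity), hγ, fun n hn => ?_⟩
  obtain ⟨n, rfl⟩ : ∃ k, n = k + 1 := ⟨n - 1, by omega⟩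
  rcases Nat.eq_zero_or_pos n with rfl | hn0
  · have : |e' 1| / s * s = |e' 1| := div_mul_cancel₀ _ hs0.ne'
    simp only [zero_add, Nat.cast_one, Real.one_rpow, Real.rpow_one]
    have h1 : 0 < C * M * s := by positivity
    linarith [le_abs_self (e' 1), add_mul (C * M) (|e' 1| / s) s]
  · have hn1 : (1 : ℝ) ≤ n := by exact_mod_cast hn0
    calc e' (n + 1) ≤ C * e n := hle n
      _ ≤ C * (M * r ^ ((n : ℝ) ^ γ)) := by gcongr; exact h n hn0
      _ ≤ C * (M * r ^ ((1 / 2 * (n + 1 : ℝ)) ^ γ)) := by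
        gcongr C * (M * ?_)
        refine Real.rpow_le_rpow_of_exponent_ge hr hr1.le ?_
        gcongr
        linarith
      _ = C * M * s ^ (((n + 1 : ℕ) : ℝ) ^ γ) := by
        rw [hs, ← Real.rpow_mul hr.le, Real.mul_rpow (by positivity) (by positivity)]
        push_cast; ring
      _ ≤ _ := by
        gcongr
        exact le_add_of_nonneg_right (by positivity)

lemma summable_rpow_rpow {r γ : ℝ} (hr : 0 < r) (hr1 : r < 1) (hγ : 0 < γ) :
    Summable fun k : ℕ => r ^ ((k : ℝ) ^ γ) := by
  refine summable_of_isBigO_nat (Real.summable_one_div_nat_pow.2 one_lt_two)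
    (Asymptotics.IsBigO.of_bound ((2 / (γ * -Real.log r)) ^ (2 / γ)) ?_)
  filter_upwards [eventually_ge_atTop 1] with k hk
  have hk0 : (0 : ℝ) < k := by exact_mod_cast hk
  have h := rpow_mul_rpow_rpow_le hr hr1 hγ zero_le_two hk0.le
  rw [Real.norm_of_nonneg (by positivity), Real.norm_of_nonneg (by positivity), mul_one_div,
    le_div_iff₀ (by positivity), mul_comm]
  exact_mod_cast h

/-! ### Functions and polynomials on the segment -/

lemma extendR_of_mem (f : C(unitSegment, ℝ)) {x : ℝ} (hx : x ∈ unitSegment) :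
    extendR f x = f ⟨x, hx⟩ :=
  Set.IccExtend_of_mem _ _ hx

lemma continuous_extendR (f : C(unitSegment, ℝ)) : Continuous (extendR f) :=
  f.continuous.Icc_extend'

lemma abs_extendR_le (f : C(unitSegment, ℝ)) (x : ℝ) : |extendR f x| ≤ ‖f‖ :=
  f.norm_coe_le_norm _

lemma extendR_add (f g : C(unitSegment, ℝ)) (x : ℝ) :
    extendR (f + g) x = extendR f x + extendR g x := rfl

lemma extendR_smul (c : ℝ) (f : C(unitSegment, ℝ)) (x : ℝ) :
    extendR (c • f) x = c * extendR f x := rfl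

lemma extendR_polyOn (P : Polynomial ℝ) {x : ℝ} (hx : x ∈ unitSegment) :
    extendR (polyOn P) x = P.eval x := by
  rw [extendR_of_mem _ hx]; rfl

lemma cos_mem_unitSegment (θ : ℝ) : Real.cos θ ∈ unitSegment :=
  ⟨Real.neg_one_le_cos θ, Real.cos_le_one θ⟩

lemma abs_T_eval_le_one (k : ℕ) {x : ℝ} (hx : x ∈ unitSegment) :
    |(T ℝ k).eval x| ≤ 1 :=
  Polynomial.Chebyshev.abs_eval_T_real_le_one k (abs_le.2 hx)

lemma norm_polyOn_T_le_one (k : ℕ) : ‖polyOn (T ℝ k)‖ ≤ 1 :=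
  (ContinuousMap.norm_le _ zero_le_one).2 fun x => abs_T_eval_le_one k x.2

/-- The restriction of polynomials to `[-1, 1]`, as a linear map. -/
noncomputable def polyOnLin : Polynomial ℝ →ₗ[ℝ] C(unitSegment, ℝ) :=
  (Polynomial.toContinuousMapOnAlgHom unitSegment).toLinearMap

lemma polyOnLin_apply (P : Polynomial ℝ) : polyOnLin P = polyOn P := rfl

/-! ### Chebyshev coefficients -/

lemma chebCoeff_eq_integral_cos (f : C(unitSegment, ℝ)) (k : ℕ) :
    chebCoeff f k =
      2 / Real.pi * ∫ θ in (0 : ℝ)..Real.pi, extendR f (Real.cos θ) * Real.cos (k * θ) := by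
  have h := Polynomial.Chebyshev.integral_measureT_eq_integral_cos
    (f := fun x => extendR f x * (T ℝ k).eval x)
  rw [Polynomial.Chebyshev.integral_measureT] at h
  simp only [Polynomial.Chebyshev.T_real_cos, Int.cast_natCast] at h
  rw [chebCoeff, ← h]
  simp only [Real.sqrt_inv, div_eq_mul_inv]

lemma abs_mul_abs_le_of_le_one {a b c : ℝ} (ha : |a| ≤ c) (hb : |b| ≤ 1) : |a| * |b| ≤ c :=
  (mul_le_of_le_one_right (abs_nonneg a) hb).trans ha

/-- The `k`-th cosine coefficient of `θ ↦ g (cos θ)`: the Chebyshev coefficient of `g`, for a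
function that need not be continuous outside `[-1, 1]`. -/
noncomputable def cosCoeff (g : ℝ → ℝ) (k : ℕ) : ℝ :=
  2 / Real.pi * ∫ θ in (0 : ℝ)..Real.pi, g (Real.cos θ) * Real.cos (k * θ)

lemma abs_cosCoeff_le {g : ℝ → ℝ} {C : ℝ} (hg : ∀ x ∈ unitSegment, |g x| ≤ C) (k : ℕ) :
    |cosCoeff g k| ≤ 2 * C := by
  have h := intervalIntegral.norm_integral_le_of_norm_le_const (a := (0 : ℝ)) (b := Real.pi)
    (f := fun θ => g (Real.cos θ) * Real.cos (k * θ)) (C := C) (fun θ _ => by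
      rw [norm_mul, Real.norm_eq_abs, Real.norm_eq_abs]
      exact abs_mul_abs_le_of_le_one (hg _ (cos_mem_unitSegment θ)) (Real.abs_cos_le_one _))
  rw [sub_zero, abs_of_pos Real.pi_pos, Real.norm_eq_abs] at h
  rw [cosCoeff, abs_mul, abs_of_pos (by positivity)]
  calc 2 / Real.pi * _ ≤ 2 / Real.pi * (C * Real.pi) := by gcongr
    _ = 2 * C := by field_simp

lemma abs_chebCoeff_le (f : C(unitSegment, ℝ)) (k : ℕ) : |chebCoeff f k| ≤ 2 * ‖f‖ := by
  rw [chebCoeff_eq_integral_cos]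
  exact abs_cosCoeff_le (fun x _ => abs_extendR_le f x) k

/-- The Chebyshev coefficient `A_k`, as a continuous linear functional on `C[-1, 1]`. -/
noncomputable def chebCoeffCLM (k : ℕ) : C(unitSegment, ℝ) →L[ℝ] ℝ :=
  LinearMap.mkContinuous
    { toFun := fun f => chebCoeff f k
      map_add' := fun f g => by
        have hc (f : C(unitSegment, ℝ)) : IntervalIntegrable
            (fun θ => extendR f (Real.cos θ) * Real.cos (k * θ)) MeasureTheory.volume 0 Real.pi := by
          have := continuous_extendR f
          exact Continuous.intervalIntegrable (by fun_prop) _ _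
        simp only [chebCoeff_eq_integral_cos, extendR_add, add_mul]
        rw [intervalIntegral.integral_add (hc f) (hc g), mul_add]
      map_smul' := fun c f => by
        simp only [chebCoeff_eq_integral_cos, extendR_smul, mul_assoc,
          intervalIntegral.integral_const_mul, RingHom.id_apply, smul_eq_mul]
        ring }
    2 fun f => abs_chebCoeff_le f k

lemma chebCoeffCLM_apply (k : ℕ) (f : C(unitSegment, ℝ)) : chebCoeffCLM k f = chebCoeff f k := rfl

lemma chebCoeff_T (j k : ℕ) :
    chebCoeff (polyOn (T ℝ j)) k = if j = k then (if k = 0 then 2 else 1) else 0 := by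
  have h : chebCoeff (polyOn (T ℝ j)) k =
      2 / Real.pi * ∫ x, (T ℝ j).eval x * (T ℝ k).eval x ∂Polynomial.Chebyshev.measureT := by
    rw [Polynomial.Chebyshev.integral_measureT_eq_integral_cos, chebCoeff_eq_integral_cos]
    simp only [extendR_polyOn _ (cos_mem_unitSegment _), Polynomial.Chebyshev.T_real_cos,
      Int.cast_natCast]
  have hpi := Real.pi_ne_zero
  rw [h]
  split_ifs with hjk hk
  · subst hjk hk
    rw [Nat.cast_zero, Polynomial.Chebyshev.integral_eval_T_real_mul_self_measureT_zero]
    field_simp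
  · subst hjk
    rw [Polynomial.Chebyshev.integral_T_real_mul_self_measureT_of_ne_zero hk]
    field_simp
  · rw [Polynomial.Chebyshev.integral_eval_T_real_mul_eval_T_real_measureT_of_ne hjk, mul_zero]

/-! ### Chebyshev sums as polynomials -/

/-- Two linear maps that agree on `T_0, ..., T_n` agree on the polynomials of degree at most
`n`. -/
lemma eq_of_eq_on_T {V : Type*} [AddCommGroup V] [Module ℝ V] {n : ℕ}
    {F G : Polynomial ℝ →ₗ[ℝ] V} (h : ∀ j ≤ n, F (T ℝ j) = G (T ℝ j)) {P : Polynomial ℝ}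
    (hP : P.natDegree ≤ n) : F P = G P := by
  have hmem : P ∈ Polynomial.degreeLE ℝ n :=
    Polynomial.mem_degreeLE.2 (Polynomial.natDegree_le_iff_degree_le.1 hP)
  rw [← Polynomial.Sequence.span_degreeLE (Polynomial.Chebyshev.chebyshevTsequence ℝ)
    (fun i _ => by simp)] at hmem
  refine LinearMap.eqOn_span (s := (Polynomial.Chebyshev.chebyshevTsequence ℝ) '' Set.Iic n)
    ?_ hmem
  rintro _ ⟨j, hj, rfl⟩
  exact h j hj

lemma chebCoeff_polyOn_eq_zero {P : Polynomial ℝ} {n k : ℕ} (hP : P.natDegree ≤ n) (hk : n < k) :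
    chebCoeff (polyOn P) k = 0 := by
  refine eq_of_eq_on_T (F := (chebCoeffCLM k).toLinearMap ∘ₗ polyOnLin) (G := 0) (fun j hj => ?_) hP
  have := chebCoeff_T j k
  rwa [if_neg (by omega)] at this

/-- The polynomial `a_0 / 2 + a_1 T_1 + ... + a_n T_n` depends linearly on `a`. -/
noncomputable def chebSumLin (n : ℕ) : (ℕ → ℝ) →ₗ[ℝ] Polynomial ℝ where
  toFun a := chebSum a n
  map_add' a b := by
    simp only [chebSum, Pi.add_apply, add_div, map_add, add_mul, Finset.sum_add_distrib]
    ring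
  map_smul' c a := by
    simp only [chebSum, Pi.smul_apply, smul_eq_mul, RingHom.id_apply, Polynomial.smul_eq_C_mul,
      mul_add, Finset.mul_sum, ← mul_assoc, map_mul, mul_div_assoc]

lemma natDegree_chebSum_le (a : ℕ → ℝ) (n : ℕ) : (chebSum a n).natDegree ≤ n := by
  refine Polynomial.natDegree_add_le_of_degree_le (by simp)
    (Polynomial.natDegree_sum_le_of_forall_le _ _ fun k hk => ?_)
  refine (Polynomial.natDegree_C_mul_le _ _).trans ?_
  rw [Polynomial.Chebyshev.natDegree_T]
  exact (Finset.mem_Icc.1 hk).2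

lemma norm_polyOn_chebSum_le {a : ℕ → ℝ} {B : ℝ} (n : ℕ) (ha : ∀ k, |a k| ≤ 2 * B) :
    ‖polyOn (chebSum a n)‖ ≤ (2 * n + 1) * B := by
  have hB : 0 ≤ B := by linarith [abs_nonneg (a 0), ha 0]
  refine (ContinuousMap.norm_le _ (by positivity)).2 fun x => ?_
  change |(chebSum a n).eval (x : ℝ)| ≤ _
  simp only [chebSum, Polynomial.eval_add, Polynomial.eval_C, Polynomial.eval_finsetSum,
    Polynomial.eval_mul]
  have h1 : |∑ k ∈ Finset.Icc 1 n, a k * (T ℝ k).eval (x : ℝ)| ≤ n * (2 * B) := by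
    refine (Finset.abs_sum_le_sum_abs _ _).trans ?_
    refine (Finset.sum_le_card_nsmul _ _ (2 * B) fun k _ => ?_).trans (by simp)
    rw [abs_mul]
    exact abs_mul_abs_le_of_le_one (ha k) (abs_T_eval_le_one k x.2)
  have h2 : |a 0 / 2| ≤ B := by rw [abs_div, abs_two]; linarith [ha 0]
  calc _ ≤ |a 0 / 2| + |∑ k ∈ Finset.Icc 1 n, a k * (T ℝ k).eval (x : ℝ)| := abs_add_le _ _
    _ ≤ (2 * n + 1) * B := by linarith

/-! ### Interpolation at the zeros of a Chebyshev polynomial -/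

lemma chebNode_mem_unitSegment (m i : ℕ) : chebNode m i ∈ unitSegment :=
  cos_mem_unitSegment _

lemma chebNode_injOn (m : ℕ) : Set.InjOn (chebNode m) (Finset.Icc 1 m) := by
  intro i hi j hj hij
  simp only [Finset.coe_Icc, Set.mem_Icc] at hi hj
  have hm : (0 : ℝ) < m := by exact_mod_cast (show 0 < m by omega)
  have hmem (i : ℕ) (hi : 1 ≤ i ∧ i ≤ m) :
      (2 * (i : ℝ) - 1) / m * (Real.pi / 2) ∈ Set.Icc 0 Real.pi := by
    have h1 : (1 : ℝ) ≤ i := by exact_mod_cast hi.1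
    have h2 : (i : ℝ) ≤ m := by exact_mod_cast hi.2
    have hpi := Real.pi_pos
    have h3 : 0 ≤ (2 * (i : ℝ) - 1) / m := div_nonneg (by linarith) hm.le
    have h4 : (2 * (i : ℝ) - 1) / m ≤ 2 := by rw [div_le_iff₀ hm]; linarith
    constructor
    · positivity
    · nlinarith
  have h := Real.injOn_cos (hmem i hi) (hmem j hj) hij
  have hpi := Real.pi_ne_zero
  field_simp at h
  have : (i : ℝ) = j := by linarith
  exact_mod_cast this

/-- The interpolation at the zeros of `T_{n+1}`, `f ↦ u_n^{[n+1]}(f)`, as a linear map. -/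
noncomputable def chebInterpLin (n : ℕ) : C(unitSegment, ℝ) →ₗ[ℝ] C(unitSegment, ℝ) :=
  polyOnLin ∘ₗ chebSumLin n ∘ₗ
    { toFun := fun f => discreteChebCoeff f (n + 1)
      map_add' := fun f g => by
        ext k
        simp only [discreteChebCoeff, extendR_add, add_mul, Finset.sum_add_distrib, mul_add,
          Pi.add_apply]
      map_smul' := fun c f => by
        ext k
        simp only [discreteChebCoeff, extendR_smul, mul_assoc, ← Finset.mul_sum, Pi.smul_apply,
          RingHom.id_apply, smul_eq_mul]
        ring }

lemma chebInterpLin_apply (n : ℕ) (f : C(unitSegment, ℝ)) :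
    chebInterpLin n f = polyOn (chebU f (n + 1) n) := rfl

lemma abs_discreteChebCoeff_le (f : C(unitSegment, ℝ)) {m : ℕ} (hm : 0 < m) (k : ℕ) :
    |discreteChebCoeff f m k| ≤ 2 * ‖f‖ := by
  have hm' : (0 : ℝ) < m := by exact_mod_cast hm
  have h : |∑ i ∈ Finset.Icc 1 m, extendR f (chebNode m i) * (T ℝ k).eval (chebNode m i)| ≤
      m * ‖f‖ := by
    refine (Finset.abs_sum_le_sum_abs _ _).trans ?_
    refine (Finset.sum_le_card_nsmul _ _ ‖f‖ fun i _ => ?_).trans (by simp)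
    rw [abs_mul]
    exact abs_mul_abs_le_of_le_one (abs_extendR_le f _)
      (abs_T_eval_le_one k (chebNode_mem_unitSegment m i))
  rw [discreteChebCoeff, abs_mul, abs_of_pos (by positivity)]
  calc 2 / (m : ℝ) * _ ≤ 2 / (m : ℝ) * (m * ‖f‖) := by gcongr
    _ = 2 * ‖f‖ := by field_simp

lemma chebInterpLin_polyOn {P : Polynomial ℝ} {n : ℕ} (hP : P.natDegree ≤ n) :
    chebInterpLin n (polyOn P) = polyOn P := by
  rw [chebInterpLin_apply]
  congr 1
  have hdeg {Q : Polynomial ℝ} (hQ : Q.natDegree ≤ n) :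
      Q.degree < (Finset.Icc 1 (n + 1)).card := by
    refine (Polynomial.natDegree_le_iff_degree_le.1 hQ).trans_lt ?_
    simp only [Nat.card_Icc, Nat.add_sub_cancel]
    exact_mod_cast Nat.lt_succ_self n
  refine Polynomial.eq_of_degrees_lt_of_eval_index_eq _ (chebNode_injOn (n + 1))
    (hdeg (natDegree_chebSum_le _ _)) (hdeg hP) fun j hj => ?_
  rw [chebU_interpolates _ _ _ hj, extendR_polyOn _ (chebNode_mem_unitSegment _ _)]

/-! ### Comparison of the errors -/

lemma bestApprox_le_norm_sub {f : C(unitSegment, ℝ)} {P : Polynomial ℝ} {n : ℕ}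
    (hP : P.natDegree ≤ n) : bestApprox f n ≤ ‖f - polyOn P‖ := by
  rw [← dist_eq_norm]
  exact Metric.infDist_le_dist_of_mem ⟨P, hP, rfl⟩

lemma polysDegreeLE_nonempty (n : ℕ) : (polysDegreeLE n).Nonempty :=
  ⟨polyOn 0, 0, by simp, rfl⟩

/-- Lebesgue's inequality: a linear projection `L` onto the polynomials of degree at most `n`
approximates `f` as well as the best approximation, up to the factor `1 + ‖L‖`. -/
lemma norm_sub_le_of_projection {L : C(unitSegment, ℝ) →ₗ[ℝ] C(unitSegment, ℝ)} {n : ℕ} {B : ℝ}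
    (hB : 0 ≤ B) (hL : ∀ f, ‖L f‖ ≤ B * ‖f‖)
    (hP : ∀ P : Polynomial ℝ, P.natDegree ≤ n → L (polyOn P) = polyOn P) (f : C(unitSegment, ℝ)) :
    ‖f - L f‖ ≤ (B + 1) * bestApprox f n := by
  rw [← div_le_iff₀' (by positivity), bestApprox, Metric.le_infDist (polysDegreeLE_nonempty n)]
  rintro _ ⟨P, hPn, rfl⟩
  rw [div_le_iff₀' (by positivity), dist_eq_norm]
  have h : f - L f = (f - polyOn P) - L (f - polyOn P) := by
    rw [map_sub, hP P hPn]; abel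
  rw [h]
  calc _ ≤ ‖f - polyOn P‖ + ‖L (f - polyOn P)‖ := norm_sub_le _ _
    _ ≤ ‖f - polyOn P‖ + B * ‖f - polyOn P‖ := by gcongr; exact hL _
    _ = _ := by ring

lemma chebInterpError_le (f : C(unitSegment, ℝ)) (n : ℕ) :
    chebInterpError f n ≤ (2 * n + 2) * bestApprox f n := by
  have h := norm_sub_le_of_projection (L := chebInterpLin n) (n := n) (B := 2 * n + 1)
    (by positivity)
    (fun f => norm_polyOn_chebSum_le n (abs_discreteChebCoeff_le f n.succ_pos))
    (fun P hP => chebInterpLin_polyOn hP) f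
  rw [chebInterpError, ← chebInterpLin_apply, norm_sub_rev]
  linarith

lemma bestApprox_le_chebTruncError (f : C(unitSegment, ℝ)) (n : ℕ) :
    bestApprox f n ≤ chebTruncError f n :=
  bestApprox_le_norm_sub (natDegree_chebSum_le _ n)

lemma bestApprox_le_chebInterpError (f : C(unitSegment, ℝ)) (n : ℕ) :
    bestApprox f n ≤ chebInterpError f n := by
  rw [chebInterpError, norm_sub_rev]
  exact bestApprox_le_norm_sub (natDegree_chebSum_le _ n)

lemma abs_chebCoeff_succ_le (f : C(unitSegment, ℝ)) (n : ℕ) :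
    |chebCoeff f (n + 1)| ≤ 2 * bestApprox f n := by
  rw [← div_le_iff₀' two_pos, bestApprox, Metric.le_infDist (polysDegreeLE_nonempty n)]
  rintro _ ⟨P, hP, rfl⟩
  rw [div_le_iff₀' two_pos, dist_eq_norm]
  have h : chebCoeff f (n + 1) = chebCoeff (f - polyOn P) (n + 1) := by
    rw [← chebCoeffCLM_apply, ← chebCoeffCLM_apply, map_sub, chebCoeffCLM_apply _ (polyOn P),
      chebCoeff_polyOn_eq_zero hP n.lt_succ_self, sub_zero]
  rw [h]
  exact abs_chebCoeff_le _ _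

/-! ### Convergence of the Chebyshev series -/

/-- A continuous function on `[-1, 1]` is determined by its Chebyshev coefficients: if they all
vanish then `h` is orthogonal to the polynomials, hence to itself by Weierstrass' theorem. -/
lemma eq_zero_of_chebCoeff_eq_zero {h : C(unitSegment, ℝ)} (h0 : ∀ k, chebCoeff h k = 0) :
    h = 0 := by
  -- the inner product with `h` for the weight `(1 - x ^ 2) ^ (-1 / 2)`, up to a factor
  let Φ : C(unitSegment, ℝ) →L[ℝ] ℝ := chebCoeffCLM 0 ∘L ContinuousLinearMap.mul ℝ _ h
  have hΦ (g : C(unitSegment, ℝ)) : Φ g = chebCoeff (h * g) 0 := rfl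
  have hT (k : ℕ) : Φ (polyOn (T ℝ k)) = 0 := by
    rw [hΦ, ← h0 k, chebCoeff_eq_integral_cos, chebCoeff_eq_integral_cos]
    congr 2
    ext θ
    have : extendR (h * polyOn (T ℝ k)) (Real.cos θ) =
      extendR h (Real.cos θ) * extendR (polyOn (T ℝ k)) (Real.cos θ) := rfl
    rw [this, extendR_polyOn _ (cos_mem_unitSegment θ), Polynomial.Chebyshev.T_real_cos]
    simp
  have hpoly (P : Polynomial ℝ) : Φ (polyOn P) = 0 :=
    eq_of_eq_on_T (F := Φ.toLinearMap ∘ₗ polyOnLin) (G := 0) (fun j _ => hT j) le_rfl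
  have hself : Φ h = 0 := by
    have hmem := continuousMap_mem_polynomialFunctions_closure (-1) 1 h
    refine closure_minimal (t := {g | Φ g = 0}) ?_
      (isClosed_eq Φ.continuous continuous_const) hmem
    rintro _ ⟨P, -, rfl⟩
    exact hpoly P
  by_contra hne
  obtain ⟨x, hx⟩ := DFunLike.ne_iff.1 hne
  rw [hΦ, chebCoeff_eq_integral_cos] at hself
  have hcont : Continuous fun θ : ℝ =>
      extendR (h * h) (Real.cos θ) * Real.cos ((0 : ℕ) * θ) := by
    have := continuous_extendR (h * h)
    fun_prop
  have heq (θ : ℝ) : extendR (h * h) (Real.cos θ) * Real.cos ((0 : ℕ) * θ) =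
      extendR h (Real.cos θ) * extendR h (Real.cos θ) := by
    simp [extendR, Set.IccExtend]
  have hpos := intervalIntegral.integral_pos Real.pi_pos hcont.continuousOn
    (fun θ _ => by rw [heq]; exact mul_self_nonneg _)
    ⟨Real.arccos x, ⟨Real.arccos_nonneg _, Real.arccos_le_pi _⟩, by
      rw [heq, Real.cos_arccos x.2.1 x.2.2, extendR_of_mem h x.2]
      exact mul_self_pos.2 hx⟩
  have : 0 < 2 / Real.pi := by positivity
  exact (mul_pos this hpos).ne' hself

/-- The coefficients of the Chebyshev series of `f`: `A_0 / 2, A_1, A_2, ...`. -/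
noncomputable def chebSeriesCoeff (f : C(unitSegment, ℝ)) (k : ℕ) : ℝ :=
  if k = 0 then chebCoeff f 0 / 2 else chebCoeff f k

lemma polyOn_chebSum_eq_sum (f : C(unitSegment, ℝ)) (n : ℕ) :
    polyOn (chebSum (chebCoeff f) n) =
      ∑ k ∈ Finset.range (n + 1), chebSeriesCoeff f k • polyOn (T ℝ k) := by
  have h : chebSum (chebCoeff f) n =
      ∑ k ∈ Finset.range (n + 1), chebSeriesCoeff f k • T ℝ k := by
    rw [Finset.range_eq_Ico, Finset.sum_eq_sum_Ico_succ_bot n.succ_pos, chebSum]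
    congr 1
    · simp [chebSeriesCoeff, Polynomial.smul_eq_C_mul]
    · refine Finset.sum_congr rfl fun k hk => ?_
      rw [chebSeriesCoeff, if_neg (by have := (Finset.mem_Icc.1 hk).1; omega),
        Polynomial.smul_eq_C_mul]
  rw [h, ← polyOnLin_apply, map_sum]
  simp only [map_smul, polyOnLin_apply]

/-- A function whose Chebyshev coefficients are summable is the sum of its Chebyshev series. -/
lemma hasSum_chebSeries {f : C(unitSegment, ℝ)} (hf : Summable fun k => |chebSeriesCoeff f k|) :
    HasSum (fun k => chebSeriesCoeff f k • polyOn (T ℝ k)) f := by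
  have hs : Summable fun k => chebSeriesCoeff f k • polyOn (T ℝ k) := by
    refine Summable.of_norm_bounded hf fun k => ?_
    rw [norm_smul, Real.norm_eq_abs]
    exact mul_le_of_le_one_right (abs_nonneg _) (norm_polyOn_T_le_one k)
  have h := hs.hasSum
  suffices heq : f - ∑' k, chebSeriesCoeff f k • polyOn (T ℝ k) = 0 by
    rwa [← sub_eq_zero.1 heq] at h
  refine eq_zero_of_chebCoeff_eq_zero fun j => ?_
  have h1 := (chebCoeffCLM j).hasSum h
  have h2 : HasSum (fun k => chebCoeffCLM j (chebSeriesCoeff f k • polyOn (T ℝ k)))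
      (chebCoeff f j) := by
    have h3 : chebCoeffCLM j (chebSeriesCoeff f j • polyOn (T ℝ j)) = chebCoeff f j := by
      rw [map_smul, chebCoeffCLM_apply, chebCoeff_T, if_pos rfl, chebSeriesCoeff, smul_eq_mul]
      split_ifs with hj
      · subst hj; ring
      · ring
    rw [← h3]
    refine hasSum_single j fun k hk => ?_
    rw [map_smul, chebCoeffCLM_apply, chebCoeff_T, if_neg hk, smul_zero]
  rw [← chebCoeffCLM_apply, map_sub, chebCoeffCLM_apply, h1.unique h2, sub_self]

/-- Subexponential decay of the Chebyshev coefficients, from the index `0` on. -/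
lemma IsSubexpDecay.exists_abs_chebSeriesCoeff_le {f : C(unitSegment, ℝ)}
    (h : IsSubexpDecay fun n => |chebCoeff f n|) :
    ∃ M r γ : ℝ, 0 < M ∧ 0 < r ∧ r < 1 ∧ 0 < γ ∧
      ∀ k : ℕ, |chebSeriesCoeff f k| ≤ M * r ^ ((k : ℝ) ^ γ) := by
  obtain ⟨M, r, γ, hM, hr, hr1, hγ, h⟩ := h
  refine ⟨M + |chebSeriesCoeff f 0|, r, γ, by positivity, hr, hr1, hγ, fun k => ?_⟩
  rcases Nat.eq_zero_or_pos k with rfl | hk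
  · simp [Real.zero_rpow hγ.ne', hM.le]
  · rw [chebSeriesCoeff, if_neg hk.ne']
    refine (h k hk).trans ?_
    gcongr
    exact le_add_of_nonneg_right (abs_nonneg _)

lemma IsSubexpDecay.chebTruncError {f : C(unitSegment, ℝ)}
    (h : IsSubexpDecay fun n => |chebCoeff f n|) : IsSubexpDecay (chebTruncError f) := by
  obtain ⟨M, r, γ, hM, hr, hr1, hγ, h⟩ := h.exists_abs_chebSeriesCoeff_le
  have hs : 0 < √r := Real.sqrt_pos.2 hr
  have hs1 := sqrt_lt_one_of_lt_one hr1
  have hS := summable_rpow_rpow hs hs1 hγ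
  have hS0 : 0 < ∑' k : ℕ, √r ^ ((k : ℝ) ^ γ) :=
    hS.tsum_pos (fun k => by positivity) 0 (by positivity)
  refine ⟨M * ∑' k : ℕ, √r ^ ((k : ℝ) ^ γ), √r, γ, by positivity, hs, hs1, hγ, fun n _ => ?_⟩
  have hf := hasSum_chebSeries (Summable.of_nonneg_of_le (fun k => abs_nonneg _) h
    ((summable_rpow_rpow hr hr1 hγ).mul_left M))
  have htail : f - polyOn (chebSum (chebCoeff f) n) =
      ∑' k, chebSeriesCoeff f (k + (n + 1)) • polyOn (T ℝ (k + (n + 1) : ℕ)) := by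
    rw [polyOn_chebSum_eq_sum, sub_eq_iff_eq_add']
    nth_rw 1 [← hf.tsum_eq]
    exact (hf.summable.sum_add_tsum_nat_add (n + 1)).symm
  rw [_root_.chebTruncError, htail]
  have hbound := ((hS.mul_left (M * √r ^ ((n : ℝ) ^ γ)))).hasSum
  rw [tsum_mul_left] at hbound
  refine (tsum_of_norm_bounded hbound fun k => ?_).trans_eq (by ring)
  rw [norm_smul, Real.norm_eq_abs]
  calc |chebSeriesCoeff f (k + (n + 1))| * ‖polyOn (T ℝ (k + (n + 1) : ℕ))‖
      ≤ |chebSeriesCoeff f (k + (n + 1))| :=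
        mul_le_of_le_one_right (abs_nonneg _) (norm_polyOn_T_le_one _)
    _ ≤ M * r ^ (((k + (n + 1) : ℕ) : ℝ) ^ γ) := h _
    _ = M * (√r ^ (((k + (n + 1) : ℕ) : ℝ) ^ γ) * √r ^ (((k + (n + 1) : ℕ) : ℝ) ^ γ)) := by
        rw [rpow_eq_sqrt_mul_sqrt hr]
    _ ≤ M * (√r ^ ((n : ℝ) ^ γ) * √r ^ ((k : ℝ) ^ γ)) := by
        gcongr M * (?_ * ?_)
        all_goals
          refine Real.rpow_le_rpow_of_exponent_ge hs hs1.le ?_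
          gcongr
          omega
    _ = _ := by ring

/-! ### Derivatives of the Chebyshev series -/

lemma abs_iterate_derivative_T_le (k n : ℕ) {x : ℝ} (hx : x ∈ unitSegment) :
    |(Polynomial.derivative^[n] (T ℝ k)).eval x| ≤ (k : ℝ) ^ (2 * n) := by
  have hone (n : ℕ) : 0 ≤ (Polynomial.derivative^[n] (T ℝ k)).eval 1 :=
    (abs_nonneg _).trans
      (Polynomial.Chebyshev.abs_iterate_derivative_T_real_le k n (x := 1) (by simp))
  refine (Polynomial.Chebyshev.abs_iterate_derivative_T_real_le k n (abs_le.2 hx)).trans ?_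
  induction n with
  | zero => simp
  | succ n ih =>
    have h := Polynomial.Chebyshev.iterate_derivative_T_eval_one_recurrence (R := ℝ) k n
    rw [Int.cast_natCast] at h
    have h1 := mul_nonneg (sq_nonneg (n : ℝ)) (hone n)
    have h2 := mul_nonneg (Nat.cast_nonneg (α := ℝ) n) (hone (n + 1))
    calc (Polynomial.derivative^[n + 1] (T ℝ k)).eval 1
        ≤ (k : ℝ) ^ 2 * (Polynomial.derivative^[n] (T ℝ k)).eval 1 := by linarith
      _ ≤ (k : ℝ) ^ 2 * (k : ℝ) ^ (2 * n) := by gcongr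
      _ = (k : ℝ) ^ (2 * (n + 1)) := by ring

/-- Term by term differentiation of a series on a closed interval, with one-sided derivatives at
the end points. -/
lemma hasDerivWithinAt_tsum_Icc {a b : ℝ} (hab : a < b) {g g' : ℕ → ℝ → ℝ} {u : ℕ → ℝ}
    (hu : Summable u) (hg : ∀ k x, HasDerivAt (g k) (g' k x) x)
    (hg'c : ∀ k, ContinuousOn (g' k) (Set.Icc a b))
    (hg'u : ∀ k, ∀ x ∈ Set.Icc a b, ‖g' k x‖ ≤ u k)
    (hgc : ContinuousOn (fun x => ∑' k, g k x) (Set.Icc a b))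
    (hsum : ∀ x ∈ Set.Icc a b, Summable fun k => g k x) {x : ℝ} (hx : x ∈ Set.Icc a b) :
    HasDerivWithinAt (fun y => ∑' k, g k y) (∑' k, g' k x) (Set.Icc a b) x := by
  have hd : ∀ y ∈ Set.Ioo a b, HasDerivAt (fun y => ∑' k, g k y) (∑' k, g' k y) y := fun y hy =>
    hasDerivAt_tsum_of_isPreconnected hu isOpen_Ioo isPreconnected_Ioo (fun k z _ => hg k z)
      (fun k z hz => hg'u k z (Set.Ioo_subset_Icc_self hz)) hy
      (hsum y (Set.Ioo_subset_Icc_self hy)) hy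
  have hc' : ContinuousOn (fun y => ∑' k, g' k y) (Set.Icc a b) := continuousOn_tsum hg'c hu hg'u
  have hcl : closure (Set.Ioo a b) = Set.Icc a b := closure_Ioo hab.ne
  rw [← hcl]
  refine hasFDerivWithinAt_closure_of_tendsto_fderiv
    (fun y hy => (hd y hy).differentiableAt.differentiableWithinAt) (convex_Ioo a b) isOpen_Ioo
    (fun y hy => (hgc y (hcl ▸ hy)).mono Set.Ioo_subset_Icc_self) ?_
  have ht : Tendsto (fun y => ContinuousLinearMap.toSpanSingleton ℝ (∑' k, g' k y))
      (𝓝[Set.Ioo a b] x) (𝓝 (ContinuousLinearMap.toSpanSingleton ℝ (∑' k, g' k x))) :=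
    ((ContinuousLinearMap.toSpanSingletonCLE (𝕜 := ℝ) (E := ℝ)).continuous.tendsto _).comp
      ((hc' x hx).mono Set.Ioo_subset_Icc_self)
  refine ht.congr' ?_
  filter_upwards [self_mem_nhdsWithin] with y hy
  exact (hd y hy).hasFDerivAt.fderiv.symm

/-- A chain of functions each of which is the derivative of the preceding one gives the iterated
derivatives of the first one. -/
lemma iteratedDerivWithin_eq_of_hasDerivWithinAt {s : Set ℝ} (hs : UniqueDiffOn ℝ s)
    {G : ℕ → ℝ → ℝ} (hG : ∀ n, ∀ x ∈ s, HasDerivWithinAt (G n) (G (n + 1) x) s x) (n : ℕ) :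
    Set.EqOn (iteratedDerivWithin n (G 0) s) (G n) s := by
  induction n with
  | zero => intro x _; simp
  | succ n ih =>
    intro x hx
    rw [iteratedDerivWithin_succ, derivWithin_congr ih (ih hx)]
    exact (hG n x hx).derivWithin (hs x hx)

lemma contDiffOn_infty_of_hasDerivWithinAt {s : Set ℝ} (hs : UniqueDiffOn ℝ s)
    {G : ℕ → ℝ → ℝ} (hG : ∀ n, ∀ x ∈ s, HasDerivWithinAt (G n) (G (n + 1) x) s x) :
    ContDiffOn ℝ ∞ (G 0) s :=
  contDiffOn_of_differentiableOn_deriv fun n _ x hx =>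
    (hG n x hx).differentiableWithinAt.congr
      (fun _ hy => iteratedDerivWithin_eq_of_hasDerivWithinAt hs hG n hy)
      (iteratedDerivWithin_eq_of_hasDerivWithinAt hs hG n hx)

lemma uniqueDiffOn_unitSegment : UniqueDiffOn ℝ unitSegment := uniqueDiffOn_Icc (by norm_num)

/-- The `n`-th derivative of the Chebyshev series is dominated by `∑ M r ^ (k ^ γ) k ^ (2 n)`,
which is of Gevrey growth in `n`, of order `2 / γ`. -/
lemma IsSubexpDecay.isGevrey {f : C(unitSegment, ℝ)}
    (h : IsSubexpDecay fun n => |chebCoeff f n|) : IsGevrey f := by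
  obtain ⟨M, r, γ, hM, hr, hr1, hγ, h⟩ := h.exists_abs_chebSeriesCoeff_le
  have hs : 0 < √r := Real.sqrt_pos.2 hr
  have hs1 := sqrt_lt_one_of_lt_one hr1
  have hl : 0 < -Real.log √r := by linarith [Real.log_neg hs hs1]
  have hS := summable_rpow_rpow hs hs1 hγ
  have hS0 : 0 < ∑' k : ℕ, √r ^ ((k : ℝ) ^ γ) :=
    hS.tsum_pos (fun k => by positivity) 0 (by positivity)
  have hf := hasSum_chebSeries (Summable.of_nonneg_of_le (fun k => abs_nonneg _) h
    ((summable_rpow_rpow hr hr1 hγ).mul_left M))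
  set R : ℝ := (2 / (γ * -Real.log √r)) ^ (2 / γ) with hR
  let g : ℕ → ℕ → ℝ → ℝ := fun n k x =>
    chebSeriesCoeff f k * (Polynomial.derivative^[n] (T ℝ k)).eval x
  let G : ℕ → ℝ → ℝ := fun n x => ∑' k, g n k x
  let D : ℕ → ℝ := fun n => M * R ^ n * (n : ℝ) ^ (2 / γ * n)
  have hgD (n k : ℕ) : ∀ x ∈ unitSegment, ‖g n k x‖ ≤ D n * √r ^ ((k : ℝ) ^ γ) := by
    intro x hx
    have hkey := rpow_mul_rpow_rpow_le hs hs1 hγ (q := 2 * n) (by positivity)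
      (Nat.cast_nonneg (α := ℝ) k)
    have hpow : (2 * (n : ℝ) / (γ * -Real.log √r)) ^ (2 * (n : ℝ) / γ) =
        R ^ n * (n : ℝ) ^ (2 / γ * n) := by
      rw [mul_div_right_comm 2 (n : ℝ), mul_div_right_comm 2 (n : ℝ),
        Real.mul_rpow (by positivity) (by positivity), hR, Real.rpow_mul (by positivity),
        Real.rpow_natCast]
    have hnat : (k : ℝ) ^ (2 * (n : ℝ)) = (k : ℝ) ^ (2 * n) := by
      rw [← Real.rpow_natCast]; push_cast; rfl
    rw [hpow, hnat] at hkey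
    calc ‖g n k x‖ = |chebSeriesCoeff f k| *
          |(Polynomial.derivative^[n] (T ℝ k)).eval x| := abs_mul _ _
      _ ≤ M * r ^ ((k : ℝ) ^ γ) * (k : ℝ) ^ (2 * n) := by
        gcongr
        · exact h k
        · exact abs_iterate_derivative_T_le k n hx
      _ = M * ((k : ℝ) ^ (2 * n) * √r ^ ((k : ℝ) ^ γ)) * √r ^ ((k : ℝ) ^ γ) := by
        rw [rpow_eq_sqrt_mul_sqrt hr]; ring
      _ ≤ M * (R ^ n * (n : ℝ) ^ (2 / γ * n)) * √r ^ ((k : ℝ) ^ γ) := by gcongr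
      _ = _ := by simp only [D]; ring
  have hgc (n k : ℕ) : ContinuousOn (g n k) unitSegment := by fun_prop
  have hDs (n : ℕ) : Summable fun k : ℕ => D n * √r ^ ((k : ℝ) ^ γ) := hS.mul_left _
  have hG (n : ℕ) : ∀ x ∈ unitSegment, HasDerivWithinAt (G n) (G (n + 1) x) unitSegment x :=
    fun x hx => hasDerivWithinAt_tsum_Icc (by norm_num) (hDs (n + 1))
      (fun k y => by
        simp only [g, Function.iterate_succ_apply']
        exact (Polynomial.hasDerivAt _ y).const_mul _)
      (hgc (n + 1)) (hgD (n + 1)) (continuousOn_tsum (hgc n) (hDs n) (hgD n))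
      (fun y hy => Summable.of_norm_bounded (hDs n) fun k => hgD n k y hy) hx
  have hfG : Set.EqOn (extendR f) (G 0) unitSegment := by
    intro x hx
    rw [extendR_of_mem f hx]
    exact (ContinuousMap.hasSum_apply hf ⟨x, hx⟩).tsum_eq.symm
  refine ⟨2 / γ, by positivity,
    (contDiffOn_infty_of_hasDerivWithinAt uniqueDiffOn_unitSegment hG).congr hfG,
    M * ∑' k : ℕ, √r ^ ((k : ℝ) ^ γ), R, by positivity, by positivity, fun n x hx => ?_⟩
  rw [iteratedDerivWithin_congr hfG hx,
    iteratedDerivWithin_eq_of_hasDerivWithinAt uniqueDiffOn_unitSegment hG n hx]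
  have hbound := (hDs n).hasSum
  rw [tsum_mul_left] at hbound
  refine (tsum_of_norm_bounded hbound fun k => hgD n k x hx).trans_eq ?_
  simp only [D]; ring

/-! ### Chebyshev coefficients of Gevrey functions -/

/-- Integration by parts: `2 k A_k(g) = A_{k-1}(g') - A_{k+1}(g')` for `k ≥ 1`. -/
lemma cosCoeff_succ_eq {g g' : ℝ → ℝ} (hg' : ContinuousOn g' unitSegment)
    (hg : ∀ x ∈ unitSegment, HasDerivWithinAt g (g' x) unitSegment x) (k : ℕ) :
    cosCoeff g (k + 1) = (cosCoeff g' k - cosCoeff g' (k + 2)) / (2 * (k + 1)) := by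
  have hk : (k : ℝ) + 1 ≠ 0 := by positivity
  have hgc : ContinuousOn g unitSegment := fun x hx => (hg x hx).continuousWithinAt
  have hgcos : Continuous fun θ : ℝ => g (Real.cos θ) :=
    hgc.comp_continuous Real.continuous_cos cos_mem_unitSegment
  have hgcos' : Continuous fun θ : ℝ => g' (Real.cos θ) :=
    hg'.comp_continuous Real.continuous_cos cos_mem_unitSegment
  have hint (i : ℕ) : IntervalIntegrable (fun θ => g' (Real.cos θ) * Real.cos (i * θ))
      MeasureTheory.volume 0 Real.pi :=
    (hgcos'.mul (by fun_prop)).intervalIntegrable _ _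
  have hparts := intervalIntegral.integral_mul_deriv_eq_deriv_mul_of_hasDerivAt
    (a := 0) (b := Real.pi) (u := fun θ => g (Real.cos θ))
    (u' := fun θ => g' (Real.cos θ) * -Real.sin θ)
    (v := fun θ => Real.sin ((k + 1) * θ) / (k + 1)) (v' := fun θ => Real.cos ((k + 1) * θ))
    hgcos.continuousOn (by fun_prop)
    (fun θ hθ => by
      rw [min_eq_left Real.pi_pos.le, max_eq_right Real.pi_pos.le] at hθ
      have hlt1 : Real.cos θ < 1 := by
        have := Real.cos_lt_cos_of_nonneg_of_le_pi le_rfl hθ.2.le hθ.1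
        rwa [Real.cos_zero] at this
      have hlt2 : -1 < Real.cos θ := by
        have := Real.cos_lt_cos_of_nonneg_of_le_pi hθ.1.le le_rfl hθ.2
        rwa [Real.cos_pi] at this
      exact ((hg _ (cos_mem_unitSegment θ)).hasDerivAt (Icc_mem_nhds hlt2 hlt1)).comp θ
        (Real.hasDerivAt_cos θ))
    (fun θ _ => by
      have h := ((Real.hasDerivAt_sin (((k : ℝ) + 1) * θ)).comp θ
        ((hasDerivAt_id θ).const_mul ((k : ℝ) + 1))).div_const ((k : ℝ) + 1)
      simpa [Function.comp_def, hk] using h)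
    ((hgcos'.mul Real.continuous_sin.neg).intervalIntegrable _ _)
    (Continuous.intervalIntegrable (by fun_prop) _ _)
  have hsin : Real.sin (((k : ℝ) + 1) * Real.pi) = 0 := by
    have := Real.sin_nat_mul_pi (k + 1)
    rwa [Nat.cast_succ] at this
  have hprod (θ : ℝ) : g' (Real.cos θ) * -Real.sin θ * (Real.sin ((k + 1) * θ) / (k + 1)) =
      -(g' (Real.cos θ) * Real.cos (k * θ) - g' (Real.cos θ) * Real.cos ((k + 2 : ℕ) * θ)) /
        (2 * (k + 1)) := by
    have e1 : (k : ℝ) * θ = (k + 1) * θ - θ := by ring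
    have e2 : ((k + 2 : ℕ) : ℝ) * θ = (k + 1) * θ + θ := by push_cast; ring
    rw [e1, e2, Real.cos_sub, Real.cos_add]
    field_simp
    ring
  simp only [hprod, hsin, mul_zero, Real.sin_zero, zero_div, sub_zero, zero_sub] at hparts
  rw [intervalIntegral.integral_div, intervalIntegral.integral_neg,
    intervalIntegral.integral_sub (hint k) (hint (k + 2))] at hparts
  simp only [cosCoeff]
  rw [Nat.cast_succ, hparts]
  field_simp

/-- Integrating by parts `j` times while the index stays above `K` gains a factor `K ^ j`. -/
lemma abs_cosCoeff_le_div_pow {F : ℕ → ℝ → ℝ} {D : ℕ → ℝ}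
    (hF : ∀ p, ∀ x ∈ unitSegment, HasDerivWithinAt (F p) (F (p + 1) x) unitSegment x)
    (hD : ∀ p, ∀ x ∈ unitSegment, |F p x| ≤ D p) {K : ℝ} (hK : 0 < K) (j : ℕ) :
    ∀ p k : ℕ, K + j ≤ k → |cosCoeff (F p) k| ≤ 2 * D (p + j) / K ^ j := by
  induction j with
  | zero => intro p k _; simpa using abs_cosCoeff_le (hD p) k
  | succ j ih =>
    intro p k hk
    push_cast at hk
    have hk0 : (0 : ℝ) < k := by linarith [Nat.cast_nonneg (α := ℝ) j]
    obtain ⟨k, rfl⟩ : ∃ i, k = i + 1 := ⟨k - 1, by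
      have : 0 < k := by exact_mod_cast hk0
      omega⟩
    push_cast at hk hk0
    have h1 := ih (p + 1) k (by linarith)
    have h2 := ih (p + 1) (k + 2) (by push_cast; linarith)
    have hc : ContinuousOn (F (p + 1)) unitSegment :=
      fun x hx => (hF (p + 1) x hx).continuousWithinAt
    have hB : 0 ≤ 2 * D (p + 1 + j) / K ^ j := (abs_nonneg _).trans h1
    rw [cosCoeff_succ_eq hc (hF p), abs_div, abs_of_pos (by positivity : (0 : ℝ) < 2 * (k + 1)),
      div_le_iff₀ (by positivity)]
    calc |cosCoeff (F (p + 1)) k - cosCoeff (F (p + 1)) (k + 2)|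
        ≤ 2 * D (p + 1 + j) / K ^ j + 2 * D (p + 1 + j) / K ^ j :=
          (abs_sub _ _).trans (add_le_add h1 h2)
      _ = 2 * D (p + 1 + j) / K ^ j / K * (2 * K) := by field_simp; ring
      _ ≤ 2 * D (p + 1 + j) / K ^ j / K * (2 * (k + 1)) := by gcongr; linarith
      _ = _ := by rw [pow_succ, ← div_div, add_assoc p 1 j, add_comm 1 j]

/-- With `p = n + n₀`, where `2 M < 2 ^ n₀`, `p` integrations by parts give `|A_m(f)| ≤ 2 ^ (-n)`
for `m` at least a multiple of `n ^ (1 + α)`. -/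
lemma IsGevrey.isPolyModulus {f : C(unitSegment, ℝ)} (hf : IsGevrey f) :
    IsPolyModulus fun n => |chebCoeff f n| := by
  obtain ⟨α, hα, hsm, M, R, hM, hR, hD⟩ := hf
  have hF (p : ℕ) : ∀ x ∈ unitSegment,
      HasDerivWithinAt (iteratedDerivWithin p (extendR f) unitSegment)
        (iteratedDerivWithin (p + 1) (extendR f) unitSegment x) unitSegment x := by
    intro x hx
    rw [iteratedDerivWithin_succ]
    exact ((hsm.differentiableOn_iteratedDerivWithin (m := p) (by exact_mod_cast WithTop.coe_lt_top _)
      uniqueDiffOn_unitSegment) x hx).hasDerivWithinAt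
  obtain ⟨n₀, hn₀⟩ := pow_unbounded_of_one_lt (2 * M) one_lt_two
  refine ⟨2 * (1 + n₀) + 4 * R * (1 + n₀ : ℝ) ^ α, 1 + α, by positivity, by positivity,
    fun n hn m hm => ?_⟩
  have hn1 : (1 : ℝ) ≤ n := by exact_mod_cast hn
  set p : ℕ := n + n₀ with hp
  have hpn : (p : ℝ) ≤ (1 + n₀) * n := by
    rw [hp]; push_cast; nlinarith [Nat.cast_nonneg (α := ℝ) n₀]
  have hnβ : (n : ℝ) ≤ (n : ℝ) ^ (1 + α) := by
    simpa using Real.rpow_le_rpow_of_exponent_le hn1 (by linarith : 1 ≤ 1 + α)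
  have hnα : (n : ℝ) ^ α ≤ (n : ℝ) ^ (1 + α) :=
    Real.rpow_le_rpow_of_exponent_le hn1 (by linarith)
  have hpα : (p : ℝ) ^ α ≤ (1 + n₀ : ℝ) ^ α * (n : ℝ) ^ (1 + α) := by
    calc (p : ℝ) ^ α ≤ ((1 + n₀) * n : ℝ) ^ α := by gcongr
      _ = (1 + n₀ : ℝ) ^ α * (n : ℝ) ^ α := Real.mul_rpow (by positivity) (by positivity)
      _ ≤ _ := by gcongr
  have hA : 0 ≤ 2 * (1 + n₀ : ℝ) * (n : ℝ) ^ (1 + α) := by positivity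
  have hB : 0 ≤ 4 * R * (1 + n₀ : ℝ) ^ α * (n : ℝ) ^ (1 + α) := by positivity
  have hm1 : 2 * (p : ℝ) ≤ m := by
    have : 2 * (p : ℝ) ≤ 2 * ((1 + n₀) * (n : ℝ) ^ (1 + α)) := by
      gcongr; exact hpn.trans (by gcongr)
    linarith
  have hm2 : 4 * R * (p : ℝ) ^ α ≤ m := by
    have : 4 * R * (p : ℝ) ^ α ≤ 4 * R * ((1 + n₀ : ℝ) ^ α * (n : ℝ) ^ (1 + α)) := by gcongr
    linarith
  have hp0 : (0 : ℝ) < p := by rw [hp]; push_cast; positivity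
  have hm0 : (0 : ℝ) < m := by linarith
  have hbound := abs_cosCoeff_le_div_pow hF hD (half_pos hm0) p 0 m (by linarith)
  simp only [zero_add, iteratedDerivWithin_zero] at hbound
  simp only [chebCoeff_eq_integral_cos]
  refine hbound.trans ?_
  have hhalf : 2 * R * (p : ℝ) ^ α / m ≤ 1 / 2 := by
    rw [div_le_div_iff₀ hm0 two_pos]
    linarith
  calc 2 * (M * R ^ p * (p : ℝ) ^ (α * p)) / (m / 2 : ℝ) ^ p
      = 2 * M * (2 * R * (p : ℝ) ^ α / m) ^ p := by
        rw [Real.rpow_mul hp0.le, Real.rpow_natCast, div_pow, div_pow, mul_pow, mul_pow]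
        field_simp
    _ ≤ 2 ^ n₀ * (1 / 2) ^ p := by
        gcongr
    _ = 1 / 2 ^ n := by
        rw [hp, one_div_pow, pow_add]; field_simp

/-! ### The equivalences -/

theorem theorem5p2p4 (f : C(unitSegment, ℝ)) :
    List.TFAE
      [ ∃ M r γ : ℝ, 0 < M ∧ 0 < r ∧ r < 1 ∧ 0 < γ ∧
          ∀ n : ℕ, 0 < n → bestApprox f n ≤ M * r ^ ((n : ℝ) ^ γ),
        ∃ M r γ : ℝ, 0 < M ∧ 0 < r ∧ r < 1 ∧ 0 < γ ∧
          ∀ n : ℕ, 0 < n → chebTruncError f n ≤ M * r ^ ((n : ℝ) ^ γ),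
        ∃ M r γ : ℝ, 0 < M ∧ 0 < r ∧ r < 1 ∧ 0 < γ ∧
          ∀ n : ℕ, 0 < n → |chebCoeff f n| ≤ M * r ^ ((n : ℝ) ^ γ),
        ∃ M r γ : ℝ, 0 < M ∧ 0 < r ∧ r < 1 ∧ 0 < γ ∧
          ∀ n : ℕ, 0 < n → chebInterpError f n ≤ M * r ^ ((n : ℝ) ^ γ),
        ∃ c β : ℝ, 0 < c ∧ 0 < β ∧
          ∀ n : ℕ, 0 < n → ∀ m : ℕ, c * (n : ℝ) ^ β ≤ m → bestApprox f m ≤ 1 / 2 ^ n,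
        ∃ c β : ℝ, 0 < c ∧ 0 < β ∧
          ∀ n : ℕ, 0 < n → ∀ m : ℕ, c * (n : ℝ) ^ β ≤ m → chebTruncError f m ≤ 1 / 2 ^ n,
        ∃ c β : ℝ, 0 < c ∧ 0 < β ∧
          ∀ n : ℕ, 0 < n → ∀ m : ℕ, c * (n : ℝ) ^ β ≤ m → |chebCoeff f m| ≤ 1 / 2 ^ n,
        ∃ c β : ℝ, 0 < c ∧ 0 < β ∧
          ∀ n : ℕ, 0 < n → ∀ m : ℕ, c * (n : ℝ) ^ β ≤ m → chebInterpError f m ≤ 1 / 2 ^ n,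
        IsGevrey f ] := by
  have hpred := fun h : IsSubexpDecay (bestApprox f) =>
    h.of_le_pred (e' := fun n => |chebCoeff f n|) two_pos (abs_chebCoeff_succ_le f)
  tfae_have 1 → 3 := hpred
  tfae_have 3 → 2 := IsSubexpDecay.chebTruncError
  tfae_have 2 → 1 := fun h => IsSubexpDecay.mono h (bestApprox_le_chebTruncError f)
  tfae_have 1 → 4 := fun h => IsSubexpDecay.of_le_mul h (chebInterpError_le f)
  tfae_have 4 → 1 := fun h => IsSubexpDecay.mono h (bestApprox_le_chebInterpError f)
  tfae_have 1 ↔ 5 := isSubexpDecay_iff_isPolyModulus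
  tfae_have 2 ↔ 6 := isSubexpDecay_iff_isPolyModulus
  tfae_have 3 ↔ 7 := isSubexpDecay_iff_isPolyModulus
  tfae_have 4 ↔ 8 := isSubexpDecay_iff_isPolyModulus
  tfae_have 3 → 9 := IsSubexpDecay.isGevrey
  tfae_have 9 → 7 := IsGevrey.isPolyModulus
  tfae_finish
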